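/- Let $\mathbb K\in\{\mathbb R,\mathbb C\}$, $m\ge 1$ an integer, $0<p<\infty$ and $1\le q\le\infty$. Write $\ell_2^N$ for $\mathbb K^N$ with the Euclidean norm. For a continuous $m$-linear map $T:E_1\times\dots\times E_m\to X$ between normed spaces over $\mathbb K$, let $\pi_p(T)$ be its multiple $p$-summing norm: the infimum of all $C>0$ such that for all finite sequences $(x^i_{j})_{j=1}^{J_i}\subset E_i$, $i=1,\dots,m$, $$\Big(\sum_{j_1,\dots,j_m}\|T(x^1_{j_1},\dots,x^m_{j_m})\|_X^p\Big)^{1/p}\le C\prod_{i=1}^m w_p\big((x^i_{j})_{j}\big),\qquad w_p\big((y_j)_j\big)=\sup_{\gamma\in B_{E'}}\Big(\sum_j|\gamma(y_j)|^p\Big)^{1/p};$$ $T$ is multiple $p$-summing if such a $C$ exists. For $1\le\lambda<\infty$, a normed space $X$ is an $\mathcal L^g_{q,\lambda}$-space if for every finite dimensional subspace $M\subset X$ and every $\varepsilon>0$ there are $n\in\mathbb N$ and linear maps $R:M\to\ell_q^n$, $S:\ell_q^n\to X$ such that $SR$ is the inclusion $M\hookrightarrow X$ and $\|S\|\,\|R\|\le\lambda+\varepsilon$.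 (a) Suppose that $p\ge q$, or that $p<2$ and $q<2$. Then for every $\lambda\ge1$ there are constants $C_1,C_2>0$, depending only on $m,p,q,\lambda$ and $\mathbb K$, such that for every $N\ge1$, every $\mathcal L^g_{q,\lambda}$-space $X$ and every $m$-linear map $T:(\ell_2^N)^m\to X$, the map $T$ is multiple $p$-summing and $$\pi_p(T)\le C_1\Big(\frac{\Gamma(N+p/2)}{\Gamma(N)}\Big)^{m/p}\|T\|,\qquad \Big(\frac{\Gamma(N+p/2)}{\Gamma(N)}\Big)^{m/p}\|T\|\le C_2\,N^{m/2}\|T\|.$$ (b) If $p\le 2$ and $q\le2$, the exponent $m/2$ is optimal: the space $\ell_q$ is an $\mathcal L^g_{q,1}$-space, and there is a constant $c>0$, depending only on $m,p,q$ and $\mathbb K$, such that for every $N\ge1$ there is an $m$-linear map $T:(\ell_2^N)^m\to\ell_q$ that is multiple $p$-summing with $\|T\|=1$ and $\pi_p(T)\ge c\,N^{m/2}$. -/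

import Mathlib

open scoped ENNReal

noncomputable section

/-- The weak `p`-norm `w_p((y_j)_j) = sup { (∑_j |γ(y_j)|^p)^{1/p} : γ ∈ B_{E'} }` of a finite
sequence of vectors of `E`. -/
def weakSummingNorm (𝕜 : Type*) [RCLike 𝕜] {E : Type*} [NormedAddCommGroup E] [NormedSpace 𝕜 E]
    (p : ℝ) {n : ℕ} (y : Fin n → E) : ℝ :=
  sSup {s : ℝ | ∃ γ : E →L[𝕜] 𝕜, ‖γ‖ ≤ 1 ∧ s = (∑ j, ‖γ (y j)‖ ^ p) ^ (1 / p)}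

/-- `C` is an admissible constant in the definition of a multiple `p`-summing operator `T`. -/
def MultipleSummingBound {𝕜 : Type*} [RCLike 𝕜] {m : ℕ} {E : Fin m → Type*}
    [∀ i, NormedAddCommGroup (E i)] [∀ i, NormedSpace 𝕜 (E i)]
    {F : Type*} [NormedAddCommGroup F] [NormedSpace 𝕜 F]
    (p : ℝ) (T : ContinuousMultilinearMap 𝕜 E F) (C : ℝ) : Prop :=
  ∀ (J : Fin m → ℕ) (x : ∀ i, Fin (J i) → E i),
    (∑ j : (∀ i, Fin (J i)), ‖T (fun i => x i (j i))‖ ^ p) ^ (1 / p) ≤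
      C * ∏ i, weakSummingNorm 𝕜 p (x i)

/-- `T` is multiple `p`-summing. -/
def IsMultipleSumming {𝕜 : Type*} [RCLike 𝕜] {m : ℕ} {E : Fin m → Type*}
    [∀ i, NormedAddCommGroup (E i)] [∀ i, NormedSpace 𝕜 (E i)]
    {F : Type*} [NormedAddCommGroup F] [NormedSpace 𝕜 F]
    (p : ℝ) (T : ContinuousMultilinearMap 𝕜 E F) : Prop :=
  ∃ C : ℝ, 0 < C ∧ MultipleSummingBound p T C

/-- The multiple `p`-summing norm `π_p(T)`, the infimum of the admissible constants
(meaningful when `T` is multiple `p`-summing). -/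
def multipleSummingNorm {𝕜 : Type*} [RCLike 𝕜] {m : ℕ} {E : Fin m → Type*}
    [∀ i, NormedAddCommGroup (E i)] [∀ i, NormedSpace 𝕜 (E i)]
    {F : Type*} [NormedAddCommGroup F] [NormedSpace 𝕜 F]
    (p : ℝ) (T : ContinuousMultilinearMap 𝕜 E F) : ℝ :=
  sInf {C : ℝ | 0 < C ∧ MultipleSummingBound p T C}

/-- `X` is an `𝓛^g_{q,lam}`-space: for every finite dimensional subspace `M` and every `ε > 0` the
inclusion `M → X` factors as `S ∘ R` through some `ℓ_q^n` with `‖S‖ ‖R‖ ≤ lam + ε`. -/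
def IsLgSpace (𝕜 : Type*) [RCLike 𝕜] (q : ℝ≥0∞) [Fact (1 ≤ q)] (lam : ℝ)
    (X : Type*) [NormedAddCommGroup X] [NormedSpace 𝕜 X] : Prop :=
  ∀ M : Submodule 𝕜 X, FiniteDimensional 𝕜 M → ∀ ε : ℝ, 0 < ε →
    ∃ (n : ℕ) (R : M →L[𝕜] PiLp q (fun _ : Fin n => 𝕜))
      (S : PiLp q (fun _ : Fin n => 𝕜) →L[𝕜] X),
      S.comp R = M.subtypeL ∧ ‖S‖ * ‖R‖ ≤ lam + ε

end

/-! Everything reduces to Rademacher averages. Each sign functional `x ↦ ∑ ± x i` on `ℓ_2^N` has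
norm at most `√N`, while by Khinchine its `p`-th power averages over all signs to at least a
constant times `‖x‖ ^ p`. Averaging the weak `p`-norm inequality over these functionals gives `(∑ ‖y
j‖ ^ p) ^ (1 / p) ≤ K √N w_p(y)`. With `‖T x‖ ≤ ‖T‖ ∏ ‖x i‖`, the multiple sum factors into `m` such
sums, whence `π_p(T) ≤ K ^ m N ^ (m / 2) ‖T‖`. The Gamma quotient to the power `m / p` is comparable
to `N ^ (m / 2)`, which gives (a).

For (b), send `(x_1, …, x_m)` to the family of products of sign sums, indexed by all `m`-tuples of
sign vectors and normalised in `ℓ_q` (`rademacherProduct`). For `q ≤ 2` its norm is 1, and it takes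
norm 1 on every tuple of basis vectors. Testing on the basis, whose weak `p`-norm is at most `N ^ (1
/ p - 1 / 2)`, forces `π_p ≥ N ^ (m / 2)`. -/

/-- The Rademacher sum `∑ ± x i` with signs given by `ε`. -/
noncomputable def signSum {𝕜 : Type*} [RCLike 𝕜] {n : ℕ} (x : Fin n → 𝕜) (ε : Fin n → Bool) : 𝕜 :=
  ∑ i, (if ε i then x i else -x i)

/-! ### Moments of Rademacher sums and Khinchine's lower bound -/

section Khinchine

variable {𝕜 : Type*} [RCLike 𝕜]

lemma sum_signs_succ {n : ℕ} (x : Fin (n + 1) → 𝕜) (F : 𝕜 → ℝ) :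
    ∑ ε, F (signSum x ε) =
      ∑ ε : Fin n → Bool, (F (x 0 + signSum (fun i => x i.succ) ε) +
        F (-x 0 + signSum (fun i => x i.succ) ε)) := by
  rw [← (Fin.consEquiv (fun _ : Fin (n + 1) => Bool)).sum_comp, Fintype.sum_prod_type,
    Fintype.sum_bool, ← Finset.sum_add_distrib]
  refine Finset.sum_congr rfl fun ε _ => ?_
  simp [signSum, Fin.sum_univ_succ, Fin.consEquiv]

lemma norm_add_sq_add_norm_neg_add_sq (a b : 𝕜) :
    ‖a + b‖ ^ 2 + ‖-a + b‖ ^ 2 = 2 * (‖a‖ ^ 2 + ‖b‖ ^ 2) := by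
  have h := parallelogram_law_with_norm 𝕜 b a
  rw [show a + b = b + a by ring, show -a + b = b - a by ring]
  nlinarith [h]

lemma norm_add_pow_four_add_norm_neg_add_pow_four_le (a b : 𝕜) :
    ‖a + b‖ ^ 4 + ‖-a + b‖ ^ 4 ≤ 2 * (‖a‖ ^ 4 + 6 * ‖a‖ ^ 2 * ‖b‖ ^ 2 + ‖b‖ ^ 4) := by
  have h1 : ‖a + b‖ ^ 2 = ‖a‖ ^ 2 + 2 * RCLike.re (inner 𝕜 a b) + ‖b‖ ^ 2 :=
    norm_add_sq (𝕜 := 𝕜) a b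
  have h2 := norm_add_sq_add_norm_neg_add_sq a b
  have h3 : |RCLike.re (inner 𝕜 a b)| ≤ ‖a‖ * ‖b‖ :=
    (RCLike.abs_re_le_norm _).trans (norm_inner_le_norm a b)
  have h4 : RCLike.re (inner 𝕜 a b) ^ 2 ≤ (‖a‖ * ‖b‖) ^ 2 := sq_le_sq' (abs_le.1 h3).1 (abs_le.1 h3).2
  have h5 : ‖-a + b‖ ^ 2 = ‖a‖ ^ 2 - 2 * RCLike.re (inner 𝕜 a b) + ‖b‖ ^ 2 := by linarith
  calc ‖a + b‖ ^ 4 + ‖-a + b‖ ^ 4 = (‖a + b‖ ^ 2) ^ 2 + (‖-a + b‖ ^ 2) ^ 2 := by ring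
    _ ≤ _ := by rw [h1, h5]; nlinarith [h4]

lemma sum_signs_sq {n : ℕ} (x : Fin n → 𝕜) :
    ∑ ε, ‖signSum x ε‖ ^ 2 = 2 ^ n * ∑ i, ‖x i‖ ^ 2 := by
  induction n with
  | zero => simp [signSum]
  | succ n ih =>
    rw [sum_signs_succ x (fun z => ‖z‖ ^ 2), Fin.sum_univ_succ]
    simp only [norm_add_sq_add_norm_neg_add_sq]
    rw [← Finset.mul_sum, Finset.sum_add_distrib, ih]
    simp
    ring

/-- Induction on the first sign; the cross term `6 ‖a‖² ‖b‖²` is evaluated by the exact second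
moment. -/
lemma sum_signs_pow_four_le {n : ℕ} (x : Fin n → 𝕜) :
    ∑ ε, ‖signSum x ε‖ ^ 4 ≤ 3 * 2 ^ n * (∑ i, ‖x i‖ ^ 2) ^ 2 := by
  induction n with
  | zero => simp [signSum]
  | succ n ih =>
    rw [sum_signs_succ x (fun z => ‖z‖ ^ 4), Fin.sum_univ_succ]
    refine (Finset.sum_le_sum fun ε _ =>
      norm_add_pow_four_add_norm_neg_add_pow_four_le _ _).trans ?_
    rw [← Finset.mul_sum, Finset.sum_add_distrib, Finset.sum_add_distrib, ← Finset.mul_sum,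
      sum_signs_sq]
    have h := ih (fun i => x i.succ)
    simp only [Finset.sum_const, Finset.card_univ, Fintype.card_pi, Fintype.card_bool,
      Finset.prod_const, Fintype.card_fin, nsmul_eq_mul, Nat.cast_pow, Nat.cast_ofNat]
    have : 0 ≤ (2 : ℝ) ^ n * ‖x 0‖ ^ 4 := by positivity
    rw [pow_succ (2 : ℝ) n]
    nlinarith [h, this]

/-- Khinchine's lower inequality for Rademacher sums. -/
lemma exists_khinchine_lower (p : ℝ) (hp : 0 < p) : ∃ c : ℝ, 0 < c ∧
    ∀ (n : ℕ) (x : Fin n → 𝕜),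
      c * 2 ^ n * √(∑ i, ‖x i‖ ^ 2) ^ p ≤ ∑ ε, ‖signSum x ε‖ ^ p := by
  have hsplit (s : ℝ) (hs : 0 < s) : s ^ p = s ^ (p - 2) * s ^ 2 := by
    rw [← Real.rpow_natCast, ← Real.rpow_add hs]; norm_num
  rcases le_total p 2 with h2 | h2
  · refine ⟨2 ^ (p - 2) / 4, by positivity, fun n x => ?_⟩
    set A := ∑ i, ‖x i‖ ^ 2 with hA
    have hA0 : 0 ≤ A := Finset.sum_nonneg fun i _ => sq_nonneg ‖x i‖
    rcases hA0.eq_or_lt with h0 | h0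
    · rw [← h0, Real.sqrt_zero, Real.zero_rpow hp.ne', mul_zero]; positivity
    set σ := √A
    have hσ : 0 < σ := Real.sqrt_pos.2 h0
    have hσA : σ ^ 2 = A := Real.sq_sqrt h0.le
    -- A pointwise minorant of `t ^ p` by second and fourth powers: below `2σ` use the monotonicity
    -- of `t ^ (p - 2)`, above it the bracket is nonpositive. Averaging leaves `A - 3A / 4 = A / 4`.
    have key (t : ℝ) (ht : 0 ≤ t) :
        (2 * σ) ^ (p - 2) * (t ^ 2 - t ^ 4 / (4 * A)) ≤ t ^ p := by
      rcases ht.eq_or_lt with rfl | ht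
      · simp [Real.zero_rpow hp.ne']
      rcases le_total t (2 * σ) with h | h
      · rw [hsplit t ht]
        have h1 : t ^ 2 - t ^ 4 / (4 * A) ≤ t ^ 2 := by
          have : 0 ≤ t ^ 4 / (4 * A) := by positivity
          linarith
        have h3 : (2 * σ) ^ (p - 2) ≤ t ^ (p - 2) :=
          Real.rpow_le_rpow_of_nonpos ht h (by linarith)
        calc _ ≤ (2 * σ) ^ (p - 2) * t ^ 2 := by gcongr
          _ ≤ _ := by gcongr
      · have : t ^ 2 - t ^ 4 / (4 * A) ≤ 0 := by
          rw [sub_nonpos, le_div_iff₀ (by positivity), ← hσA]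
          have : (2 * σ) ^ 2 ≤ t ^ 2 := by gcongr
          nlinarith [sq_nonneg t]
        exact (mul_nonpos_of_nonneg_of_nonpos (by positivity) this).trans (by positivity)
    have h4 := sum_signs_pow_four_le x
    rw [← hA] at h4
    calc _ = (2 * σ) ^ (p - 2) * (2 ^ n * A - 3 * 2 ^ n * A ^ 2 / (4 * A)) := by
          rw [hsplit σ hσ, hσA, Real.mul_rpow zero_le_two hσ.le]; field_simp; ring
      _ ≤ (2 * σ) ^ (p - 2) *
          (∑ ε, ‖signSum x ε‖ ^ 2 - (∑ ε, ‖signSum x ε‖ ^ 4) / (4 * A)) := by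
          rw [sum_signs_sq]; gcongr
      _ = ∑ ε, (2 * σ) ^ (p - 2) * (‖signSum x ε‖ ^ 2 - ‖signSum x ε‖ ^ 4 / (4 * A)) := by
          rw [← Finset.mul_sum, Finset.sum_sub_distrib, Finset.sum_div]
      _ ≤ _ := Finset.sum_le_sum fun ε _ => key _ (norm_nonneg _)
  · refine ⟨(1 / 2) ^ (p - 2) * (3 / 4), by positivity, fun n x => ?_⟩
    set A := ∑ i, ‖x i‖ ^ 2 with hA
    have hA0 : 0 ≤ A := Finset.sum_nonneg fun i _ => sq_nonneg ‖x i‖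
    rcases hA0.eq_or_lt with h0 | h0
    · rw [← h0, Real.sqrt_zero, Real.zero_rpow hp.ne', mul_zero]; positivity
    set σ := √A
    have hσ : 0 < σ := Real.sqrt_pos.2 h0
    have hσA : σ ^ 2 = A := Real.sq_sqrt h0.le
    -- For `p ≥ 2` the second moment suffices: the bracket is nonpositive below `σ / 2`, and
    -- averaging leaves `3A / 4`.
    have key (t : ℝ) (ht : 0 ≤ t) : (1 / 2 * σ) ^ (p - 2) * (t ^ 2 - A / 4) ≤ t ^ p := by
      rcases le_total t (1 / 2 * σ) with h | h
      · have : t ^ 2 - A / 4 ≤ 0 := by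
          have : t ^ 2 ≤ (1 / 2 * σ) ^ 2 := by gcongr
          rw [← hσA]; linarith
        exact (mul_nonpos_of_nonneg_of_nonpos (by positivity) this).trans (by positivity)
      · have ht' : 0 < t := lt_of_lt_of_le (by positivity) h
        rw [hsplit t ht']
        have h3 : (1 / 2 * σ) ^ (p - 2) ≤ t ^ (p - 2) :=
          Real.rpow_le_rpow (by positivity) h (by linarith)
        calc _ ≤ (1 / 2 * σ) ^ (p - 2) * t ^ 2 := by gcongr; linarith
          _ ≤ _ := by gcongr
    calc _ = (1 / 2 * σ) ^ (p - 2) * (2 ^ n * A - 2 ^ n * (A / 4)) := by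
          rw [hsplit σ hσ, hσA, Real.mul_rpow (by norm_num) hσ.le]; ring
      _ = ∑ ε : Fin n → Bool, (1 / 2 * σ) ^ (p - 2) * (‖signSum x ε‖ ^ 2 - A / 4) := by
          rw [← Finset.mul_sum, Finset.sum_sub_distrib, sum_signs_sq]; simp [A]
      _ ≤ _ := Finset.sum_le_sum fun ε _ => key _ (norm_nonneg _)

end Khinchine

/-! ### Upper bound for the multiple summing norm -/

section Upper

variable {𝕜 : Type*} [RCLike 𝕜]

lemma le_weakSummingNorm {E : Type*} [NormedAddCommGroup E] [NormedSpace 𝕜 E] {p : ℝ}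
    (hp : 0 < p) {n : ℕ} (y : Fin n → E) (γ : E →L[𝕜] 𝕜) (hγ : ‖γ‖ ≤ 1) :
    (∑ j, ‖γ (y j)‖ ^ p) ^ (1 / p) ≤ weakSummingNorm 𝕜 p y := by
  refine le_csSup ⟨(∑ j, ‖y j‖ ^ p) ^ (1 / p), ?_⟩ ⟨γ, hγ, rfl⟩
  rintro s ⟨δ, hδ, rfl⟩
  gcongr with j
  simpa using δ.le_of_opNorm_le hδ (y j)

lemma weakSummingNorm_nonneg {E : Type*} [NormedAddCommGroup E] [NormedSpace 𝕜 E] {p : ℝ}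
    {n : ℕ} (y : Fin n → E) : 0 ≤ weakSummingNorm 𝕜 p y := by
  refine Real.sSup_nonneg ?_
  rintro s ⟨δ, -, rfl⟩
  positivity

/-- The functional `x ↦ ∑ ± x i` on `ℓ_2^N`. -/
noncomputable def signFunctional (𝕜 : Type*) [RCLike 𝕜] {N : ℕ} (ε : Fin N → Bool) :
    EuclideanSpace 𝕜 (Fin N) →L[𝕜] 𝕜 :=
  ∑ i, (if ε i then (1 : 𝕜) else -1) • EuclideanSpace.proj i

lemma signFunctional_apply {N : ℕ} (ε : Fin N → Bool) (x : EuclideanSpace 𝕜 (Fin N)) :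
    signFunctional 𝕜 ε x = signSum x ε := by
  simp only [signFunctional, signSum, sum_apply]
  refine Finset.sum_congr rfl fun i _ => ?_
  by_cases h : ε i <;> simp [h]

lemma norm_signFunctional_le {N : ℕ} (ε : Fin N → Bool) : ‖signFunctional 𝕜 ε‖ ≤ √N := by
  refine ContinuousLinearMap.opNorm_le_bound _ (Real.sqrt_nonneg _) fun x => ?_
  rw [signFunctional_apply, EuclideanSpace.norm_eq, ← Real.sqrt_mul (Nat.cast_nonneg _)]
  refine Real.le_sqrt_of_sq_le ?_
  have h : ‖signSum x ε‖ ≤ ∑ i, ‖x i‖ := (norm_sum_le _ _).trans_eq <|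
    Finset.sum_congr rfl fun i _ => by by_cases h : ε i <;> simp [h]
  calc ‖signSum x ε‖ ^ 2 ≤ (∑ i, ‖x i‖) ^ 2 := by gcongr
    _ ≤ _ := by simpa using sq_sum_le_card_mul_sum_sq (s := Finset.univ) (f := fun i => ‖x i‖)

/-- The identity of `ℓ_2^N` is `p`-summing with constant of order `√N`. -/
lemma exists_sum_norm_rpow_le_weakSummingNorm (𝕜 : Type*) [RCLike 𝕜] (p : ℝ) (hp : 0 < p) :
    ∃ K : ℝ, 0 < K ∧ ∀ N : ℕ, 1 ≤ N → ∀ (J : ℕ) (y : Fin J → EuclideanSpace 𝕜 (Fin N)),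
      (∑ j, ‖y j‖ ^ p) ^ (1 / p) ≤ K * √N * weakSummingNorm 𝕜 p y := by
  obtain ⟨c, hc, H⟩ := exists_khinchine_lower (𝕜 := 𝕜) p hp
  refine ⟨(c⁻¹) ^ (1 / p), by positivity, fun N hN J y => ?_⟩
  set w := weakSummingNorm 𝕜 p y with hw
  have hw0 : 0 ≤ w := weakSummingNorm_nonneg y
  have hN0 : 0 < √(N : ℝ) := Real.sqrt_pos.2 (by exact_mod_cast hN)
  have h1 (ε : Fin N → Bool) : ∑ j, ‖signSum (y j) ε‖ ^ p ≤ (√N * w) ^ p := by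
    have h2 : ‖((√N : ℝ) : 𝕜)⁻¹ • signFunctional 𝕜 ε‖ ≤ 1 := by
      rw [norm_smul, norm_inv, RCLike.norm_ofReal, abs_of_pos hN0, inv_mul_le_one₀ hN0]
      exact norm_signFunctional_le ε
    have h3 := le_weakSummingNorm hp y _ h2
    have h4 : ∑ j, ‖(((√N : ℝ) : 𝕜)⁻¹ • signFunctional 𝕜 ε) (y j)‖ ^ p =
        ((√N)⁻¹) ^ p * ∑ j, ‖signSum (y j) ε‖ ^ p := by
      rw [Finset.mul_sum]
      refine Finset.sum_congr rfl fun j _ => ?_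
      rw [smul_apply, norm_smul, signFunctional_apply, norm_inv,
        RCLike.norm_ofReal, abs_of_pos hN0, Real.mul_rpow (by positivity) (norm_nonneg _)]
    rw [h4, one_div, Real.rpow_inv_le_iff_of_pos (by positivity) hw0 hp,
      Real.inv_rpow hN0.le, inv_mul_le_iff₀ (by positivity)] at h3
    rwa [Real.mul_rpow hN0.le hw0]
  -- Khinchine is applied to the coordinates of each `y j`, then the sums over `j` and over signs
  -- are exchanged.
  have h2 : c * 2 ^ N * ∑ j, ‖y j‖ ^ p ≤ 2 ^ N * (√N * w) ^ p := by
    calc c * 2 ^ N * ∑ j, ‖y j‖ ^ p ≤ ∑ j, ∑ ε, ‖signSum (y j) ε‖ ^ p := by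
          rw [Finset.mul_sum]
          refine Finset.sum_le_sum fun j _ => ?_
          rw [EuclideanSpace.norm_eq]
          exact H N (y j)
      _ = ∑ ε, ∑ j, ‖signSum (y j) ε‖ ^ p := Finset.sum_comm
      _ ≤ ∑ ε : Fin N → Bool, (√N * w) ^ p := Finset.sum_le_sum fun ε _ => h1 ε
      _ = _ := by simp
  have h3 : ∑ j, ‖y j‖ ^ p ≤ c⁻¹ * (√N * w) ^ p := by
    rw [le_inv_mul_iff₀ hc]
    refine le_of_mul_le_mul_left ?_ (by positivity : (0 : ℝ) < 2 ^ N)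
    linarith
  calc _ ≤ (c⁻¹ * (√N * w) ^ p) ^ (1 / p) := by gcongr
    _ = _ := by
      rw [Real.mul_rpow (by positivity) (by positivity), ← Real.rpow_mul (by positivity),
        mul_one_div_cancel hp.ne', Real.rpow_one]; ring

/-- If the identity of `E` satisfies the `p`-summing inequality with constant `K`, every
`m`-linear map on `E` is multiple `p`-summing with constant `‖T‖ K ^ m`. -/
lemma multipleSummingBound_of_forall_sum_norm_le {m : ℕ} {E F : Type*} [NormedAddCommGroup E]
    [NormedSpace 𝕜 E] [NormedAddCommGroup F] [NormedSpace 𝕜 F] {p : ℝ} (hp : 0 < p) {K : ℝ}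
    (H : ∀ (J : ℕ) (y : Fin J → E),
      (∑ j, ‖y j‖ ^ p) ^ (1 / p) ≤ K * weakSummingNorm 𝕜 p y)
    (T : ContinuousMultilinearMap 𝕜 (fun _ : Fin m => E) F) {B : ℝ} (hB : ‖T‖ ≤ B) :
    MultipleSummingBound p T (K ^ m * B) := by
  intro J x
  have hB0 : 0 ≤ B := (norm_nonneg T).trans hB
  calc _ ≤ (∑ j : (∀ i, Fin (J i)), (B * ∏ i, ‖x i (j i)‖) ^ p) ^ (1 / p) := by
        gcongr with j
        exact T.le_of_opNorm_le hB _
    _ = (B ^ p * ∏ i, ∑ j, ‖x i j‖ ^ p) ^ (1 / p) := by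
        rw [Finset.prod_univ_sum, Finset.mul_sum, Fintype.piFinset_univ]
        congr 1
        refine Finset.sum_congr rfl fun j _ => ?_
        rw [Real.mul_rpow hB0 (by positivity), Real.finsetProd_rpow _ _ (by simp)]
    _ = B * ∏ i, (∑ j, ‖x i j‖ ^ p) ^ (1 / p) := by
        rw [Real.mul_rpow (by positivity) (by positivity), ← Real.rpow_mul hB0,
          mul_one_div_cancel hp.ne', Real.rpow_one,
          Real.finsetProd_rpow _ _ fun i _ => by positivity]
    _ ≤ B * ∏ i, (K * weakSummingNorm 𝕜 p (x i)) := by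
        gcongr with i
        exact H _ _
    _ = _ := by
        rw [Finset.prod_mul_distrib]; simp; ring

lemma isMultipleSumming_and_norm_le {m : ℕ} {E F : Type*} [NormedAddCommGroup E]
    [NormedSpace 𝕜 E] [NormedAddCommGroup F] [NormedSpace 𝕜 F] {p : ℝ} (hp : 0 < p) {K : ℝ}
    (hK : 0 < K) (H : ∀ (J : ℕ) (y : Fin J → E),
      (∑ j, ‖y j‖ ^ p) ^ (1 / p) ≤ K * weakSummingNorm 𝕜 p y)
    (T : ContinuousMultilinearMap 𝕜 (fun _ : Fin m => E) F) :
    IsMultipleSumming p T ∧ multipleSummingNorm p T ≤ K ^ m * ‖T‖ := by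
  -- The slack `δ` keeps the constant strictly positive even when `T = 0`; it is removed at the end.
  have hadm (δ : ℝ) (hδ : 0 < δ) : 0 < K ^ m * (‖T‖ + δ) ∧
      MultipleSummingBound p T (K ^ m * (‖T‖ + δ)) :=
    ⟨by positivity, multipleSummingBound_of_forall_sum_norm_le hp H T (by linarith)⟩
  refine ⟨⟨_, hadm 1 one_pos⟩, le_of_forall_pos_le_add fun η hη => ?_⟩
  have hδ : 0 < η / K ^ m := by positivity
  have hbdd : BddBelow {C : ℝ | 0 < C ∧ MultipleSummingBound p T C} := ⟨0, fun C hC => hC.1.le⟩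
  refine (csInf_le hbdd (hadm _ hδ)).trans_eq ?_
  field_simp

end Upper

/-! ### Growth of the Gamma quotient -/

section GammaRatio

open Filter

lemma GammaSeq_mul_Gamma_add {s : ℝ} (hs : 0 < s) (n : ℕ) :
    Real.GammaSeq s n * Real.Gamma (n + 1 + s) = (n : ℝ) ^ s * n.factorial * Real.Gamma s := by
  have h : ∀ k : ℕ, Real.Gamma (k + s) = (∏ j ∈ Finset.range k, (s + j)) * Real.Gamma s := by
    intro k
    induction k with
    | zero => simp
    | succ k ih =>
      rw [Nat.cast_succ, show (k : ℝ) + 1 + s = (k + s) + 1 by ring,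
        Real.Gamma_add_one (by positivity), ih, Finset.prod_range_succ]
      ring
  have h1 := h (n + 1)
  push_cast at h1
  have h2 : ∏ j ∈ Finset.range (n + 1), (s + j) ≠ 0 :=
    Finset.prod_ne_zero_iff.2 fun j _ => by positivity
  rw [h1, Real.GammaSeq]
  field_simp

/-- The quotient equals `N ^ s` times `Γ(s) / GammaSeq s N` and `N / (N + s)`. The first factor is
bounded above and below because `GammaSeq s N → Γ(s) > 0`, the second lies in `[1 / (1 + s), 1]`. -/
lemma exists_Gamma_ratio_bounds {s : ℝ} (hs : 0 < s) : ∃ a b : ℝ, 0 < a ∧ 0 < b ∧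
    ∀ N : ℕ, 1 ≤ N → a * (N : ℝ) ^ s ≤ Real.Gamma (N + s) / Real.Gamma N ∧
      Real.Gamma (N + s) / Real.Gamma N ≤ b * (N : ℝ) ^ s := by
  have hΓ := Real.Gamma_pos_of_pos hs
  have hlim := Real.GammaSeq_tendsto_Gamma s
  obtain ⟨B, hB⟩ := hlim.bddAbove_range
  obtain ⟨B', hB'⟩ := (hlim.inv₀ hΓ.ne').bddAbove_range
  have hpos (N : ℕ) (hN : 1 ≤ N) : 0 < Real.GammaSeq s N := by
    have : (0 : ℝ) < N := by exact_mod_cast hN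
    exact div_pos (by positivity) (Finset.prod_pos fun j _ => by positivity)
  have hB0 : 0 < B := (hpos 1 le_rfl).trans_le (hB ⟨1, rfl⟩)
  have hB0' : 0 < B' := (inv_pos.2 (hpos 1 le_rfl)).trans_le (hB' ⟨1, rfl⟩)
  refine ⟨Real.Gamma s * B⁻¹ * (1 + s)⁻¹, Real.Gamma s * B', by positivity, by positivity,
    fun N hN => ?_⟩
  have hN0 : (1 : ℝ) ≤ N := by exact_mod_cast hN
  have hg := hpos N hN
  have hN1 : (0 : ℝ) < N := by linarith
  have hΓN := Real.Gamma_pos_of_pos hN1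
  have hkey : Real.Gamma (N + s) / Real.Gamma N =
      Real.Gamma s * (Real.GammaSeq s N)⁻¹ * (N / (N + s)) * (N : ℝ) ^ s := by
    have h1 := GammaSeq_mul_Gamma_add hs N
    rw [← Real.Gamma_nat_eq_factorial, Real.Gamma_add_one hN1.ne',
      show (N : ℝ) + 1 + s = (N + s) + 1 by ring, Real.Gamma_add_one (by positivity)] at h1
    field_simp
    linarith
  have h1 : (1 + s)⁻¹ ≤ N / (N + s) := by
    rw [inv_eq_one_div, div_le_div_iff₀ (by positivity) (by positivity)]; nlinarith
  have h2 : N / (N + s) ≤ 1 := (div_le_one (by positivity)).2 (by linarith)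
  have h3 : B⁻¹ ≤ (Real.GammaSeq s N)⁻¹ := inv_anti₀ hg (hB ⟨N, rfl⟩)
  have h4 : (Real.GammaSeq s N)⁻¹ ≤ B' := hB' ⟨N, rfl⟩
  rw [hkey]
  refine ⟨by gcongr, ?_⟩
  calc _ ≤ Real.Gamma s * B' * 1 * (N : ℝ) ^ s := by gcongr
    _ = _ := by ring

lemma exists_Gamma_ratio_rpow_bounds (m : ℕ) {p : ℝ} (hp : 0 < p) : ∃ a b : ℝ, 0 < a ∧ 0 < b ∧
    ∀ N : ℕ, 1 ≤ N →
      a * (N : ℝ) ^ ((m : ℝ) / 2) ≤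
        (Real.Gamma (N + p / 2) / Real.Gamma N) ^ ((m : ℝ) / p) ∧
      (Real.Gamma (N + p / 2) / Real.Gamma N) ^ ((m : ℝ) / p) ≤
        b * (N : ℝ) ^ ((m : ℝ) / 2) := by
  obtain ⟨a, b, ha, hb, H⟩ := exists_Gamma_ratio_bounds (half_pos hp)
  refine ⟨a ^ ((m : ℝ) / p), b ^ ((m : ℝ) / p), by positivity, by positivity, fun N hN => ?_⟩
  obtain ⟨h1, h2⟩ := H N hN
  have h0 : 0 ≤ a * (N : ℝ) ^ (p / 2) := by positivity
  have hpow (t : ℝ) (ht : 0 < t) : (t * (N : ℝ) ^ (p / 2)) ^ ((m : ℝ) / p) =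
      t ^ ((m : ℝ) / p) * (N : ℝ) ^ ((m : ℝ) / 2) := by
    rw [Real.mul_rpow ht.le (by positivity), ← Real.rpow_mul (by positivity)]
    congr 2
    field_simp
  rw [← hpow a ha, ← hpow b hb]
  exact ⟨Real.rpow_le_rpow h0 h1 (by positivity),
    Real.rpow_le_rpow (h0.trans h1) h2 (by positivity)⟩

end GammaRatio

/-! ### Finite-dimensional factorisation in `ℓ_q` -/

section SequenceSpace

variable {𝕜 : Type*} [RCLike 𝕜] {q : ℝ≥0∞} [hq1 : Fact (1 ≤ q)]

lemma toReal_pos_of_one_le (hq : q ≠ ⊤) : 0 < q.toReal :=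
  ENNReal.toReal_pos (one_pos.trans_le hq1.out).ne' hq

/-- Restriction of a sequence to its first `n` coordinates. -/
noncomputable def lpTruncate (𝕜 : Type*) [RCLike 𝕜] (q : ℝ≥0∞) [hq1 : Fact (1 ≤ q)]
    (hq : q ≠ ⊤) (n : ℕ) :
    lp (fun _ : ℕ => 𝕜) q →L[𝕜] PiLp q (fun _ : Fin n => 𝕜) :=
  LinearMap.mkContinuous
    { toFun := fun x => WithLp.toLp q fun i : Fin n => x i
      map_add' := fun x y => by ext i; simp
      map_smul' := fun c x => by ext i; simp } 1 fun x => by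
    have h := toReal_pos_of_one_le hq
    rw [one_mul, PiLp.norm_eq_sum h, one_div, Real.rpow_inv_le_iff_of_pos (by positivity)
      (norm_nonneg _) h]
    refine le_trans (le_of_eq ?_) (lp.sum_rpow_le_norm_rpow h x (Finset.range n))
    simp [Finset.sum_range]

lemma norm_lpTruncate_le (hq : q ≠ ⊤) (n : ℕ) : ‖lpTruncate 𝕜 q hq n‖ ≤ 1 :=
  LinearMap.mkContinuous_norm_le _ zero_le_one _

/-- Extension of a finite sequence by zero. -/
noncomputable def lpExtend (𝕜 : Type*) [RCLike 𝕜] (q : ℝ≥0∞) [hq1 : Fact (1 ≤ q)] (n : ℕ) :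
    PiLp q (fun _ : Fin n => 𝕜) →L[𝕜] lp (fun _ : ℕ => 𝕜) q :=
  ∑ i : Fin n, (lp.singleContinuousLinearMap 𝕜 (fun _ : ℕ => 𝕜) q i).comp (PiLp.proj q _ i)

lemma lpExtend_apply (n : ℕ) (y : PiLp q (fun _ : Fin n => 𝕜)) :
    lpExtend 𝕜 q n y = ∑ i : Fin n, lp.single q (i : ℕ) (y i) := by
  simp [lpExtend, sum_apply]

lemma norm_sum_fin_single (hq : q ≠ ⊤) {n : ℕ} (y : Fin n → 𝕜) :
    ‖(∑ i : Fin n, lp.single q (i : ℕ) (y i) : lp (fun _ : ℕ => 𝕜) q)‖ ^ q.toReal = ∑ i, ‖y i‖ ^ q.toReal := by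
  have h := lp.norm_sum_single (E := fun _ : ℕ => 𝕜) (toReal_pos_of_one_le hq)
    (fun i => if h : i < n then y ⟨i, h⟩ else 0) (Finset.range n)
  simpa [Finset.sum_range] using h

lemma norm_lpExtend_le (hq : q ≠ ⊤) (n : ℕ) : ‖lpExtend 𝕜 q n‖ ≤ 1 := by
  refine ContinuousLinearMap.opNorm_le_bound _ zero_le_one fun y => le_of_eq ?_
  have h := toReal_pos_of_one_le hq
  rw [one_mul, PiLp.norm_eq_sum h, lpExtend_apply, ← norm_sum_fin_single hq, ← Real.rpow_mul
    (norm_nonneg _), mul_one_div_cancel h.ne', Real.rpow_one]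

lemma tendsto_lpExtend_lpTruncate (hq : q ≠ ⊤) (x : lp (fun _ : ℕ => 𝕜) q) :
    Filter.Tendsto (fun n => lpExtend 𝕜 q n (lpTruncate 𝕜 q hq n x)) Filter.atTop (nhds x) := by
  refine (lp.hasSum_single hq x).tendsto_sum_nat.congr fun n => ?_
  rw [lpExtend_apply, Finset.sum_range]
  rfl

/-- Pointwise convergence to zero on a finite dimensional space is convergence in norm. -/
lemma exists_opNorm_lt_of_tendsto_zero {M F : Type*} [NormedAddCommGroup M] [NormedSpace 𝕜 M]
    [FiniteDimensional 𝕜 M] [NormedAddCommGroup F] [NormedSpace 𝕜 F] (D : ℕ → M →L[𝕜] F)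
    (hD : ∀ x, Filter.Tendsto (fun n => D n x) Filter.atTop (nhds 0)) {η : ℝ} (hη : 0 < η) :
    ∃ n, ‖D n‖ < η := by
  obtain ⟨C, hC, H⟩ := (Module.finBasis 𝕜 M).exists_opNorm_le (F := F)
  have h : ∀ᶠ n in Filter.atTop, ∀ i, ‖D n (Module.finBasis 𝕜 M i)‖ < η / (2 * C) := by
    refine Filter.eventually_all.2 fun i => ?_
    have := (hD (Module.finBasis 𝕜 M i)).norm
    rw [norm_zero] at this
    exact this.eventually_lt_const (by positivity)
  obtain ⟨n, hn⟩ := h.exists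
  refine ⟨n, (H (by positivity) fun i => (hn i).le).trans_lt ?_⟩
  field_simp
  linarith

lemma exists_left_inverse_one_sub {X : Type*} [NormedAddCommGroup X] [NormedSpace 𝕜 X]
    [CompleteSpace X] (A : X →L[𝕜] X) (hA : ‖A‖ < 1) :
    ∃ V : X →L[𝕜] X, V * (1 - A) = 1 ∧ ‖V‖ ≤ (1 - ‖A‖)⁻¹ := by
  refine ⟨↑(Units.oneSub A hA)⁻¹, Units.inv_mul (Units.oneSub A hA), ?_⟩
  set V : X →L[𝕜] X := ↑(Units.oneSub A hA)⁻¹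
  have h : V * (1 - A) = 1 := Units.inv_mul (Units.oneSub A hA)
  have h1 : V = 1 + V * A := by rw [mul_sub, mul_one] at h; rw [← h]; abel
  have h2 : ‖V‖ ≤ 1 + ‖V‖ * ‖A‖ := by
    calc ‖V‖ = ‖1 + V * A‖ := by rw [← h1]
      _ ≤ ‖(1 : X →L[𝕜] X)‖ + ‖V * A‖ := norm_add_le _ _
      _ ≤ _ := add_le_add ContinuousLinearMap.norm_id_le (norm_mul_le _ _)
  rw [← one_div, le_div_iff₀ (by linarith)]
  linarith

/-- `ℓ_q` is an `𝓛^g_{q,1}`-space. -/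
lemma isLgSpace_lp (hq : q ≠ ⊤) : IsLgSpace 𝕜 q 1 (lp (fun _ : ℕ => 𝕜) q) := by
  intro M hM ε hε
  obtain ⟨P, hP⟩ := Submodule.ClosedComplemented.of_finiteDimensional M
  -- Extending the truncation by zero only approximates the identity on `M`. The error `D n`,
  -- precomposed with a projection `P` onto `M`, is a small operator on the whole space; the inverse
  -- `V` of `1 - D n ∘ P` corrects the factorisation exactly.
  let D (n : ℕ) : M →L[𝕜] lp (fun _ : ℕ => 𝕜) q :=
    (ContinuousLinearMap.id 𝕜 (lp (fun _ : ℕ => 𝕜) q) - (lpExtend 𝕜 q n).comp (lpTruncate 𝕜 q hq n)).comp M.subtypeL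
  have hD (x : M) : Filter.Tendsto (fun n => D n x) Filter.atTop (nhds 0) := by
    have := (tendsto_lpExtend_lpTruncate hq (x : lp (fun _ : ℕ => 𝕜) q)).const_sub (x : lp (fun _ : ℕ => 𝕜) q)
    rwa [sub_self] at this
  -- Chosen so that `‖D n ∘ P‖ ≤ ε / (1 + ε)`, hence `‖V‖ ≤ 1 + ε`.
  have hη : 0 < ε / (1 + ε) / (‖P‖ + 1) := by positivity
  obtain ⟨n, hn⟩ := exists_opNorm_lt_of_tendsto_zero D hD hη
  have hA : ‖(D n).comp P‖ ≤ ε / (1 + ε) := by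
    calc ‖(D n).comp P‖ ≤ ‖D n‖ * ‖P‖ := ContinuousLinearMap.opNorm_comp_le _ _
      _ ≤ ε / (1 + ε) / (‖P‖ + 1) * (‖P‖ + 1) := by gcongr; linarith
      _ = _ := by field_simp
  have hlt : ε / (1 + ε) < 1 := (div_lt_one (by positivity)).2 (by linarith)
  obtain ⟨V, hV, hVn⟩ := exists_left_inverse_one_sub _ (hA.trans_lt hlt)
  have hVε : ‖V‖ ≤ 1 + ε := hVn.trans <| by
    rw [inv_le_comm₀ (by linarith) (by positivity)]
    have : ε / (1 + ε) = 1 - (1 + ε)⁻¹ := by field_simp; ring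
    linarith
  refine ⟨n, (lpTruncate 𝕜 q hq n).comp M.subtypeL, V.comp (lpExtend 𝕜 q n), ?_, ?_⟩
  · ext1 x
    have h1 := congrArg (fun W : lp (fun _ : ℕ => 𝕜) q →L[𝕜] lp (fun _ : ℕ => 𝕜) q => W (x : lp (fun _ : ℕ => 𝕜) q)) hV
    have h2 : (1 - (D n).comp P) (x : lp (fun _ : ℕ => 𝕜) q) = lpExtend 𝕜 q n (lpTruncate 𝕜 q hq n x) := by
      change (x : lp (fun _ : ℕ => 𝕜) q) - D n (P x) = _
      rw [hP]
      simp [D]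
    simp only [mul_apply_eq_comp] at h1
    rw [h2] at h1
    exact h1
  · have h1 : ‖V.comp (lpExtend 𝕜 q n)‖ ≤ (1 + ε) * 1 :=
      (ContinuousLinearMap.opNorm_comp_le _ _).trans
        (mul_le_mul hVε (norm_lpExtend_le hq n) (norm_nonneg _) (by positivity))
    have h2 : ‖(lpTruncate 𝕜 q hq n).comp M.subtypeL‖ ≤ 1 * 1 :=
      (ContinuousLinearMap.opNorm_comp_le _ _).trans
        (mul_le_mul (norm_lpTruncate_le hq n) M.norm_subtypeL_le (norm_nonneg _) zero_le_one)
    calc _ ≤ (1 + ε) * 1 * (1 * 1) := mul_le_mul h1 h2 (norm_nonneg _) (by positivity)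
      _ = _ := by ring

end SequenceSpace

/-! ### The extremal map and the lower bound -/

section Lower

variable {𝕜 : Type*} [RCLike 𝕜]

/-- Power-mean inequality with exponent `2 / r ≥ 1`. -/
lemma sum_rpow_le_card_rpow_mul_sum_sq_rpow {ι : Type*} (s : Finset ι) {f : ι → ℝ}
    (hf : ∀ i, 0 ≤ f i) {r : ℝ} (hr : 0 < r) (hr2 : r ≤ 2) :
    ∑ i ∈ s, f i ^ r ≤ (s.card : ℝ) ^ (1 - r / 2) * (∑ i ∈ s, f i ^ 2) ^ (r / 2) := by
  have h := Real.rpow_sum_le_const_mul_sum_rpow s (fun i => f i ^ r) ((one_le_div hr).2 hr2)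
  have h2 (i : ι) : |f i ^ r| = f i ^ r := abs_of_nonneg (Real.rpow_nonneg (hf i) _)
  have h3 (i : ι) : (f i ^ r) ^ (2 / r) = f i ^ 2 := by
    rw [← Real.rpow_mul (hf i), mul_div_cancel₀ _ hr.ne', Real.rpow_two]
  simp only [h2, h3] at h
  have h0 : 0 ≤ ∑ i ∈ s, f i ^ r := Finset.sum_nonneg fun i _ => Real.rpow_nonneg (hf i) _
  calc ∑ i ∈ s, f i ^ r = ((∑ i ∈ s, f i ^ r) ^ (2 / r)) ^ (r / 2) := by
        rw [← Real.rpow_mul h0, div_mul_div_cancel₀ hr.ne', div_self two_ne_zero, Real.rpow_one]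
    _ ≤ ((s.card : ℝ) ^ (2 / r - 1) * ∑ i ∈ s, f i ^ 2) ^ (r / 2) := by gcongr
    _ = _ := by
        rw [Real.mul_rpow (by positivity) (by positivity), ← Real.rpow_mul (by positivity)]
        congr 2
        field_simp

/-- For `r ≤ 2`, the `r`-th moment of a Rademacher sum is controlled by the second. -/
lemma sum_signs_rpow_le {r : ℝ} (hr : 0 < r) (hr2 : r ≤ 2) {n : ℕ}
    (x : EuclideanSpace 𝕜 (Fin n)) : ∑ ε, ‖signSum x ε‖ ^ r ≤ 2 ^ n * ‖x‖ ^ r := by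
  have h := sum_rpow_le_card_rpow_mul_sum_sq_rpow (Finset.univ : Finset (Fin n → Bool))
    (fun ε => norm_nonneg (signSum x ε)) hr hr2
  have hc : ((Finset.univ : Finset (Fin n → Bool)).card : ℝ) = 2 ^ n := by simp
  rw [sum_signs_sq, ← EuclideanSpace.norm_sq_eq, hc, Real.mul_rpow (by positivity) (by positivity),
    ← mul_assoc, ← Real.rpow_add (by positivity), sub_add_cancel, Real.rpow_one,
    ← Real.rpow_two, ← Real.rpow_mul (norm_nonneg _), mul_div_cancel₀ _ two_ne_zero] at h
  exact h

/-- By Riesz and Parseval, the values of a functional in the unit ball on the basis have `ℓ_2` norm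
at most 1; the power-mean inequality passes to `ℓ_p`. -/
lemma weakSummingNorm_single_le {p : ℝ} (hp : 0 < p) (hp2 : p ≤ 2) (N : ℕ) :
    weakSummingNorm 𝕜 p (fun i : Fin N => EuclideanSpace.single i (1 : 𝕜)) ≤
      (N : ℝ) ^ (1 / p - 1 / 2) := by
  refine csSup_le ⟨_, 0, by simp, rfl⟩ ?_
  rintro s ⟨γ, hγ, rfl⟩
  have h1 : ∑ i, ‖γ (EuclideanSpace.single i (1 : 𝕜))‖ ^ 2 ≤ 1 := by
    set w := (InnerProductSpace.toDual 𝕜 (EuclideanSpace 𝕜 (Fin N))).symm γ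
    have hw : ‖w‖ ≤ 1 := by simpa [w] using hγ
    have h2 (i : Fin N) : γ (EuclideanSpace.single i (1 : 𝕜)) =
        inner 𝕜 w (EuclideanSpace.basisFun (Fin N) 𝕜 i) := by
      rw [InnerProductSpace.toDual_symm_apply, EuclideanSpace.basisFun_apply]
    simp only [h2]
    rw [OrthonormalBasis.sum_sq_norm_inner_left]
    exact pow_le_one₀ (norm_nonneg _) hw
  have h2 := sum_rpow_le_card_rpow_mul_sum_sq_rpow (Finset.univ : Finset (Fin N))
    (fun i => norm_nonneg (γ (EuclideanSpace.single i (1 : 𝕜)))) hp hp2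
  have h3 : (∑ i, ‖γ (EuclideanSpace.single i (1 : 𝕜))‖ ^ 2) ^ (p / 2) ≤ 1 :=
    Real.rpow_le_one (by positivity) h1 (by positivity)
  calc _ ≤ ((N : ℝ) ^ (1 - p / 2) * 1) ^ (1 / p) := by
        rw [Finset.card_univ, Fintype.card_fin] at h2
        gcongr
        exact h2.trans (by gcongr)
    _ = _ := by
        rw [mul_one, ← Real.rpow_mul (Nat.cast_nonneg _)]
        congr 1
        field_simp

variable {q : ℝ≥0∞} [hq1 : Fact (1 ≤ q)]

/-- The product of Rademacher sums, as an `m`-linear map into `ℓ_q`. -/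
noncomputable def rademacherProduct (𝕜 : Type*) [RCLike 𝕜] (q : ℝ≥0∞) [hq1 : Fact (1 ≤ q)]
    (m N : ℕ) :
    ContinuousMultilinearMap 𝕜 (fun _ : Fin m => EuclideanSpace 𝕜 (Fin N))
      (lp (fun _ : ℕ => 𝕜) q) :=
  ∑ k : Fin (Fintype.card (Fin m → Fin N → Bool)),
    ((ContinuousMultilinearMap.mkPiAlgebra 𝕜 (Fin m) 𝕜).compContinuousLinearMap fun i =>
      signFunctional 𝕜 ((Fintype.equivFin (Fin m → Fin N → Bool)).symm k i)).smulRight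
    -- The weight `2 ^ (-N m / q)` turns the `ℓ_q` norm into an `L_q` norm over uniformly
    -- distributed signs.
    (lp.single q (k : ℕ) ((((2 : ℝ) ^ (N * m)) ^ (-(1 / q.toReal)) : ℝ) : 𝕜))

lemma norm_rademacherProduct_rpow (hq : q ≠ ⊤) {m N : ℕ}
    (x : Fin m → EuclideanSpace 𝕜 (Fin N)) :
    ‖rademacherProduct 𝕜 q m N x‖ ^ q.toReal =
      ∏ i, ((2 ^ N)⁻¹ * ∑ ε, ‖signSum (x i) ε‖ ^ q.toReal) := by
  have h := toReal_pos_of_one_le hq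
  have h1 : rademacherProduct 𝕜 q m N x =
      ∑ k : Fin (Fintype.card (Fin m → Fin N → Bool)), lp.single q (k : ℕ)
        ((∏ i, signSum (x i) ((Fintype.equivFin (Fin m → Fin N → Bool)).symm k i)) *
          ((((2 : ℝ) ^ (N * m)) ^ (-(1 / q.toReal)) : ℝ) : 𝕜)) := by
    simp only [rademacherProduct, sum_apply,
      ContinuousMultilinearMap.smulRight_apply,
      ContinuousMultilinearMap.compContinuousLinearMap_apply,
      ContinuousMultilinearMap.mkPiAlgebra_apply, signFunctional_apply, ← lp.single_smul,
      smul_eq_mul]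
  have h2 : (((2 : ℝ) ^ (N * m)) ^ (-(1 / q.toReal))) ^ q.toReal = ((2 ^ N)⁻¹) ^ m := by
    rw [← Real.rpow_mul (by positivity), neg_mul, one_div_mul_cancel h.ne', Real.rpow_neg_one,
      pow_mul, inv_pow]
  rw [h1, norm_sum_fin_single hq, Finset.prod_mul_distrib, Finset.prod_univ_sum,
    Fintype.piFinset_univ, Finset.prod_const, Finset.card_univ, Fintype.card_fin, ← h2,
    Finset.mul_sum,
    ← (Fintype.equivFin (Fin m → Fin N → Bool)).symm.sum_comp]
  refine Finset.sum_congr rfl fun k _ => ?_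
  rw [norm_mul, RCLike.norm_ofReal, abs_of_nonneg (by positivity),
    Real.mul_rpow (norm_nonneg _) (by positivity), norm_prod,
    Real.finsetProd_rpow _ _ fun i _ => norm_nonneg _, mul_comm]

lemma norm_rademacherProduct_apply_le (hq2 : q ≤ 2) {m N : ℕ}
    (x : Fin m → EuclideanSpace 𝕜 (Fin N)) :
    ‖rademacherProduct 𝕜 q m N x‖ ≤ ∏ i, ‖x i‖ := by
  have hq : q ≠ ⊤ := (hq2.trans_lt ENNReal.ofNat_lt_top).ne
  have h := toReal_pos_of_one_le hq
  have hq2' : q.toReal ≤ 2 := by simpa using ENNReal.toReal_mono ENNReal.ofNat_ne_top hq2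
  rw [← Real.rpow_le_rpow_iff (norm_nonneg _) (by positivity) h, norm_rademacherProduct_rpow hq,
    ← Real.finsetProd_rpow _ _ fun i _ => norm_nonneg _]
  gcongr with i
  rw [inv_mul_le_iff₀ (by positivity)]
  exact sum_signs_rpow_le h hq2' (x i)

lemma norm_rademacherProduct_single (hq : q ≠ ⊤) {m N : ℕ} (j : Fin m → Fin N) :
    ‖rademacherProduct 𝕜 q m N fun i => EuclideanSpace.single (j i) (1 : 𝕜)‖ = 1 := by
  have h := toReal_pos_of_one_le hq
  have h1 (k : Fin N) (ε : Fin N → Bool) :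
      ‖signSum (EuclideanSpace.single k (1 : 𝕜)) ε‖ = 1 := by
    have : signSum (EuclideanSpace.single k (1 : 𝕜)) ε = if ε k then 1 else -1 := by
      rw [signSum, Finset.sum_eq_single k]
      · simp
      · intro i _ hi
        simp [hi]
      · simp
    rw [this]
    split_ifs <;> simp
  rw [← Real.rpow_left_inj (norm_nonneg _) zero_le_one h.ne', norm_rademacherProduct_rpow hq]
  simp only [h1, Real.one_rpow]
  simp

lemma norm_rademacherProduct (hq2 : q ≤ 2) {m N : ℕ} (hN : 1 ≤ N) :
    ‖rademacherProduct 𝕜 q m N‖ = 1 := by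
  have hq : q ≠ ⊤ := (hq2.trans_lt ENNReal.ofNat_lt_top).ne
  refine le_antisymm (ContinuousMultilinearMap.opNorm_le_bound zero_le_one fun x => ?_) ?_
  · rw [one_mul]
    exact norm_rademacherProduct_apply_le hq2 x
  · have h := (rademacherProduct 𝕜 q m N).le_opNorm
      fun _ => EuclideanSpace.single (⟨0, hN⟩ : Fin N) (1 : 𝕜)
    rw [norm_rademacherProduct_single hq fun _ : Fin m => (⟨0, hN⟩ : Fin N)] at h
    simpa using h

lemma rpow_le_of_multipleSummingBound_rademacherProduct {p : ℝ} (hp : 0 < p) (hp2 : p ≤ 2)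
    (hq : q ≠ ⊤) {m N : ℕ} (hN : 1 ≤ N) {C : ℝ} (hC : 0 < C)
    (h : MultipleSummingBound p (rademacherProduct 𝕜 q m N) C) :
    (N : ℝ) ^ ((m : ℝ) / 2) ≤ C := by
  have hN0 : (0 : ℝ) < N := by exact_mod_cast hN
  have h1 := h (fun _ => N) fun _ j => EuclideanSpace.single j (1 : 𝕜)
  have h2 : (∑ j : (Fin m → Fin N), ‖rademacherProduct 𝕜 q m N
      fun i => EuclideanSpace.single (j i) (1 : 𝕜)‖ ^ p) ^ (1 / p) = (N : ℝ) ^ (m / p) := by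
    simp only [norm_rademacherProduct_single hq, Real.one_rpow]
    simp only [Finset.sum_const, Finset.card_univ, Fintype.card_pi, Fintype.card_fin,
      Finset.prod_const, nsmul_eq_mul, mul_one, Nat.cast_pow]
    rw [← Real.rpow_natCast, ← Real.rpow_mul hN0.le, mul_one_div]
  rw [h2] at h1
  have h3 : (N : ℝ) ^ (m / p) ≤ C * ((N : ℝ) ^ (1 / p - 1 / 2)) ^ m := by
    refine h1.trans ?_
    rw [Finset.prod_const, Finset.card_univ, Fintype.card_fin]
    gcongr
    · exact weakSummingNorm_nonneg _
    · exact weakSummingNorm_single_le hp hp2 N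
  have h4 : (N : ℝ) ^ ((m : ℝ) / p) =
      (N : ℝ) ^ ((m : ℝ) / 2) * ((N : ℝ) ^ (1 / p - 1 / 2)) ^ m := by
    rw [← Real.rpow_natCast _ m, ← Real.rpow_mul hN0.le, ← Real.rpow_add hN0]
    congr 1
    ring
  rw [h4] at h3
  exact le_of_mul_le_mul_right h3 (by positivity)

end Lower

theorem mainTheorem8 {𝕜 : Type*} [RCLike 𝕜] (m : ℕ) (hm : 1 ≤ m) (p : ℝ) (hp : 0 < p)
    (q : ℝ≥0∞) [Fact (1 ≤ q)] :
    ((q ≤ ENNReal.ofReal p ∨ (p < 2 ∧ q < 2)) →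
      ∀ lam : ℝ, 1 ≤ lam → ∃ C₁ : ℝ, 0 < C₁ ∧ ∃ C₂ : ℝ, 0 < C₂ ∧
        ∀ (N : ℕ), 1 ≤ N →
        ∀ (X : Type*) [NormedAddCommGroup X] [NormedSpace 𝕜 X], IsLgSpace 𝕜 q lam X →
        ∀ T : ContinuousMultilinearMap 𝕜 (fun _ : Fin m => EuclideanSpace 𝕜 (Fin N)) X,
          IsMultipleSumming p T ∧
          multipleSummingNorm p T ≤
            C₁ * ((Real.Gamma ((N : ℝ) + p / 2) / Real.Gamma (N : ℝ)) ^ ((m : ℝ) / p) * ‖T‖) ∧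
          (Real.Gamma ((N : ℝ) + p / 2) / Real.Gamma (N : ℝ)) ^ ((m : ℝ) / p) * ‖T‖ ≤
            C₂ * ((N : ℝ) ^ ((m : ℝ) / 2) * ‖T‖)) ∧
    (p ≤ 2 → q ≤ 2 →
      IsLgSpace 𝕜 q 1 (lp (fun _ : ℕ => 𝕜) q) ∧
      ∃ c : ℝ, 0 < c ∧ ∀ N : ℕ, 1 ≤ N →
        ∃ T : ContinuousMultilinearMap 𝕜 (fun _ : Fin m => EuclideanSpace 𝕜 (Fin N))
            (lp (fun _ : ℕ => 𝕜) q),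
          ‖T‖ = 1 ∧ IsMultipleSumming p T ∧
          c * (N : ℝ) ^ ((m : ℝ) / 2) ≤ multipleSummingNorm p T) := by
  obtain ⟨K, hK, H⟩ := exists_sum_norm_rpow_le_weakSummingNorm 𝕜 p hp
  refine ⟨fun _ lam _ => ?_, fun hp2 hq2 => ?_⟩
  · obtain ⟨a, b, ha, hb, hΓ⟩ := exists_Gamma_ratio_rpow_bounds m hp
    refine ⟨K ^ m / a, by positivity, b, hb, fun N hN X _ _ _ T => ?_⟩
    obtain ⟨hΓ1, hΓ2⟩ := hΓ N hN
    have hN0 : (0 : ℝ) < N := by exact_mod_cast hN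
    have hN2 : √(N : ℝ) ^ m = (N : ℝ) ^ ((m : ℝ) / 2) := by
      rw [Real.sqrt_eq_rpow, ← Real.rpow_natCast, ← Real.rpow_mul hN0.le]
      congr 1
      ring
    obtain ⟨h1, h2⟩ := isMultipleSumming_and_norm_le hp (by positivity : 0 < K * √(N : ℝ))
      (H N hN) T
    refine ⟨h1, h2.trans ?_, ?_⟩
    · rw [mul_pow, hN2, ← mul_assoc, div_mul_eq_mul_div]
      refine mul_le_mul_of_nonneg_right ?_ (norm_nonneg T)
      rw [le_div_iff₀ ha, mul_assoc, mul_comm _ a]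
      gcongr
    · rw [← mul_assoc]
      gcongr
  · have hq : q ≠ ⊤ := (hq2.trans_lt ENNReal.ofNat_lt_top).ne
    refine ⟨isLgSpace_lp hq, 1, one_pos, fun N hN => ?_⟩
    have hN0 : (0 : ℝ) < N := by exact_mod_cast hN
    have hT := (isMultipleSumming_and_norm_le hp (by positivity : 0 < K * √(N : ℝ))
      (H N hN) (rademacherProduct 𝕜 q m N)).1
    refine ⟨rademacherProduct 𝕜 q m N, norm_rademacherProduct hq2 hN, hT, ?_⟩
    rw [one_mul]
    exact le_csInf hT fun C hC =>
      rpow_le_of_multipleSummingBound_rademacherProduct hp hp2 hq hN hC.1 hC.2
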